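/- Let $\Delta$ be a finite abstract simplicial complex (simplices are non-empty). A primitive discrete vector field on $\Delta$ is a pair $(\sigma,\tau)$ of simplices of $\Delta$ with $\sigma<\tau$ and $\dim\tau=\dim\sigma+1$. A discrete vector field on $\Delta$ is a finite set $V$ of primitive discrete vector fields such that every simplex of $\Delta$ lies in at most one pair of $V$. A $V$-path is a sequence $\sigma_0,\tau_0,\sigma_1,\tau_1,\dots,\tau_{m-1},\sigma_m$ of simplices of $\Delta$, with all $\sigma_i$ of one dimension $p$ and all $\tau_i$ of dimension $p+1$, such that $(\sigma_i,\tau_i)\in V$ and $\tau_i>\sigma_{i+1}\neq\sigma_i$ for all $0\le i\le m-1$; it is a $V$-cycle if $m>0$ and $\sigma_m=\sigma_0$, and $V$ is acyclic if there are no $V$-cycles. The generalized Morse complex $\mathcal{GM}(\Delta)$ is the simplicial complex whose simplices are the non-empty discrete vector fields on $\Delta$, with face relation given by inclusion, and the Morse complex $\mathcal{M}(\Delta)$ is its subcomplex consisting of the acyclic discrete vector fields. Then (the geometric realization of) $\mathcal{M}(\Delta)$ is connected if and only if $\mathcal{GM}(\Delta)$ is connected, and $\mathcal{M}(\Delta)$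 is simply connected if and only if $\mathcal{GM}(\Delta)$ is simply connected. (Here connected and simply connected spaces are understood to be non-empty, and simply connected spaces to be connected.) -/

import Mathlib

/-- A primitive discrete vector field on `Δ`: a pair of simplices `σ < τ` of `Δ`, with
`dim τ = dim σ + 1`. Equivalently, an edge of the Hasse diagram of `Δ`. -/
@[ext]
structure PrimitiveVectorField {V : Type*} (Δ : PreAbstractSimplicialComplex V) where
  lower : Finset V
  upper : Finset V
  lower_mem : lower ∈ Δ.faces
  upper_mem : upper ∈ Δ.faces
  lower_ssubset_upper : lower ⊂ upper
  card_upper : upper.card = lower.card + 1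

namespace PrimitiveVectorField

/-- Two primitive discrete vector fields are compatible if the two simplices of one
are distinct from the two simplices of the other. -/
def Compatible {V : Type*} {Δ : PreAbstractSimplicialComplex V}
    (p q : PrimitiveVectorField Δ) : Prop :=
  p.lower ≠ q.lower ∧ p.lower ≠ q.upper ∧ p.upper ≠ q.lower ∧ p.upper ≠ q.upper

end PrimitiveVectorField

/-- A discrete vector field on `Δ`: a collection of pairwise compatible primitive discrete
vector fields, that is, every simplex of `Δ` lies in at most one pair of the collection. -/
def IsDiscreteVectorField {V : Type*} {Δ : PreAbstractSimplicialComplex V}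
    (W : Finset (PrimitiveVectorField Δ)) : Prop :=
  ∀ p ∈ W, ∀ q ∈ W, p ≠ q → p.Compatible q

/-- `σ 0, τ 0, σ 1, τ 1, …, τ (m - 1), σ m` is a `W`-path: for some `d`, the `σ i` are
`d`-simplices and the `τ i` are `(d + 1)`-simplices of `Δ` (a `d`-simplex has `d + 1` vertices),
and for `i < m` the pair `(σ i, τ i)` belongs to `W` and `τ i > σ (i + 1) ≠ σ i`.
The values `σ i` for `i > m` and `τ i` for `i ≥ m` play no role. -/
def IsVectorFieldPath {V : Type*} {Δ : PreAbstractSimplicialComplex V}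
    (W : Finset (PrimitiveVectorField Δ)) (m : ℕ) (σ τ : ℕ → Finset V) : Prop :=
  ∃ d : ℕ,
    (∀ i ≤ m, σ i ∈ Δ.faces ∧ (σ i).card = d + 1) ∧
    (∀ i < m, τ i ∈ Δ.faces ∧ (τ i).card = d + 2) ∧
    ∀ i < m, (∃ p ∈ W, p.lower = σ i ∧ p.upper = τ i) ∧
      σ (i + 1) ⊂ τ i ∧ σ (i + 1) ≠ σ i

/-- A `W`-cycle is a closed non-trivial `W`-path. -/
def IsVectorFieldCycle {V : Type*} {Δ : PreAbstractSimplicialComplex V}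
    (W : Finset (PrimitiveVectorField Δ)) (m : ℕ) (σ τ : ℕ → Finset V) : Prop :=
  IsVectorFieldPath W m σ τ ∧ 0 < m ∧ σ m = σ 0

/-- `W` is acyclic if there are no `W`-cycles. -/
def IsAcyclicVectorField {V : Type*} {Δ : PreAbstractSimplicialComplex V}
    (W : Finset (PrimitiveVectorField Δ)) : Prop :=
  ¬ ∃ (m : ℕ) (σ τ : ℕ → Finset V), IsVectorFieldCycle W m σ τ

theorem IsDiscreteVectorField.subset {V : Type*} {Δ : PreAbstractSimplicialComplex V}
    {W W' : Finset (PrimitiveVectorField Δ)} (hW : IsDiscreteVectorField W) (h : W' ⊆ W) :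
    IsDiscreteVectorField W' :=
  fun p hp q hq hpq => hW p (h hp) q (h hq) hpq

theorem IsAcyclicVectorField.subset {V : Type*} {Δ : PreAbstractSimplicialComplex V}
    {W W' : Finset (PrimitiveVectorField Δ)} (hW : IsAcyclicVectorField W) (h : W' ⊆ W) :
    IsAcyclicVectorField W' := by
  rintro ⟨m, σ, τ, ⟨d, h1, h2, h3⟩, hm, hc⟩
  refine hW ⟨m, σ, τ, ⟨d, h1, h2, fun i hi => ?_⟩, hm, hc⟩
  obtain ⟨⟨p, hp, hp'⟩, h4⟩ := h3 i hi
  exact ⟨⟨p, h hp, hp'⟩, h4⟩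

/-- The generalized Morse complex of `Δ`: the simplicial complex whose simplices are the
(non-empty) discrete vector fields on `Δ`. -/
def generalizedMorseComplex {V : Type*} (Δ : PreAbstractSimplicialComplex V) :
    PreAbstractSimplicialComplex (PrimitiveVectorField Δ) where
  faces := {W | W.Nonempty ∧ IsDiscreteVectorField W}
  isRelLowerSet_faces := fun _ hW =>
    ⟨hW.1, fun _ hsub hne => ⟨hne, hW.2.subset hsub⟩⟩

/-- The Morse complex of `Δ`: the subcomplex of the generalized Morse complex
consisting of the acyclic discrete vector fields. -/
def morseComplex {V : Type*} (Δ : PreAbstractSimplicialComplex V) :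
    PreAbstractSimplicialComplex (PrimitiveVectorField Δ) where
  faces := {W | W ∈ (generalizedMorseComplex Δ).faces ∧ IsAcyclicVectorField W}
  isRelLowerSet_faces := fun _ hW =>
    ⟨hW.1.1, fun _ hsub hne => ⟨⟨hne, hW.1.2.subset hsub⟩, hW.2.subset hsub⟩⟩

/-- The geometric realization of an abstract simplicial complex `K` with finitely many vertices,
in barycentric coordinates: the points of `P → ℝ` with non-negative coordinates that are
supported on a face of `K` and add up to `1`, with the subspace topology. -/
def geometricRealization {P : Type*} (K : PreAbstractSimplicialComplex P) : Set (P → ℝ) :=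
  {x | (∀ p, 0 ≤ x p) ∧ ∃ s ∈ K.faces, (∀ p, p ∉ s → x p = 0) ∧ ∑ p ∈ s, x p = 1}

section Realization

open Set Topology

variable {P : Type*} {K : PreAbstractSimplicialComplex P}

/-- The closed simplex spanned by a finite set of vertices, in barycentric coordinates. -/
def closedSimplex (s : Finset P) : Set (P → ℝ) :=
  {x | (∀ p, 0 ≤ x p) ∧ (∀ p, p ∉ s → x p = 0) ∧ ∑ p ∈ s, x p = 1}

/-- The open star of a vertex in the geometric realization. -/
def openStar (K : PreAbstractSimplicialComplex P) (v : P) : Set (P → ℝ) :=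
  {x | x ∈ geometricRealization K ∧ 0 < x v}

theorem convex_closedSimplex (s : Finset P) : Convex ℝ (closedSimplex s) := by
  rintro x ⟨hx0, hxs, hx1⟩ y ⟨hy0, hys, hy1⟩ a b ha hb hab
  refine ⟨fun p => ?_, fun p hp => ?_, ?_⟩
  · have := hx0 p
    have := hy0 p
    simp only [Pi.add_apply, Pi.smul_apply, smul_eq_mul]
    positivity
  · simp [hxs p hp, hys p hp]
  · simp only [Pi.add_apply, Pi.smul_apply, smul_eq_mul, Finset.sum_add_distrib,
      ← Finset.mul_sum, hx1, hy1, mul_one, hab]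

theorem closedSimplex_subset_geometricRealization {s : Finset P} (hs : s ∈ K.faces) :
    closedSimplex s ⊆ geometricRealization K :=
  fun _ hx => ⟨hx.1, s, hs, hx.2⟩

theorem PreAbstractSimplicialComplex.mem_faces_of_subset {s t : Finset P} (hs : s ∈ K.faces)
    (hts : t ⊆ s) (ht : t.Nonempty) : t ∈ K.faces :=
  (K.isRelLowerSet_faces hs).2 hts ht

theorem exists_carrier {x : P → ℝ} (hx : x ∈ geometricRealization K) :
    ∃ s ∈ K.faces, x ∈ closedSimplex s ∧ ∀ p, p ∈ s ↔ 0 < x p := by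
  classical
  obtain ⟨h0, s, hs, hxs, h1⟩ := hx
  have hsum : ∑ p ∈ s with 0 < x p, x p = 1 := by
    rw [← h1]
    refine Finset.sum_subset (Finset.filter_subset _ _) fun p hp hp' => ?_
    simp only [Finset.mem_filter, not_and, not_lt] at hp'
    exact le_antisymm (hp' hp) (h0 p)
  refine ⟨s.filter (0 < x ·), K.mem_faces_of_subset hs (Finset.filter_subset _ _) ?_,
    ⟨h0, fun p hp => ?_, hsum⟩, fun p => ?_⟩
  · rw [Finset.nonempty_iff_ne_empty]
    rintro h
    simp [h] at hsum
  · by_contra hne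
    have hpos := lt_of_le_of_ne (h0 p) (Ne.symm hne)
    exact hp (Finset.mem_filter.2 ⟨by_contra fun h => hne (hxs p h), hpos⟩)
  · rw [Finset.mem_filter, and_iff_right_iff_imp]
    exact fun hp => by_contra fun h => hp.ne' (hxs p h)

theorem exists_pos_of_mem_geometricRealization {x : P → ℝ} (hx : x ∈ geometricRealization K) :
    ∃ p, 0 < x p := by
  obtain ⟨s, hs, -, hpos⟩ := exists_carrier hx
  obtain ⟨p, hp⟩ := (K.isRelLowerSet_faces hs).1
  exact ⟨p, (hpos p).1 hp⟩

theorem exists_face_of_pos {x : P → ℝ} (hx : x ∈ geometricRealization K) :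
    ∃ s ∈ K.faces, x ∈ closedSimplex s ∧ ∀ p, 0 < x p → p ∈ s := by
  obtain ⟨s, hs, hxs, hpos⟩ := exists_carrier hx
  exact ⟨s, hs, hxs, fun p => (hpos p).2⟩

theorem exists_forall_pos_of_mem_faces {s : Finset P} (hs : s ∈ K.faces) :
    ∃ x ∈ geometricRealization K, ∀ p ∈ s, 0 < x p := by
  classical
  have hne := (K.isRelLowerSet_faces hs).1
  have hc : (0 : ℝ) < s.card := by exact_mod_cast hne.card_pos
  refine ⟨fun p => if p ∈ s then (s.card : ℝ)⁻¹ else 0,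
    ⟨fun p => ?_, s, hs, fun p hp => if_neg hp, ?_⟩, fun p hp => ?_⟩
  · dsimp only
    split_ifs <;> positivity
  · rw [Finset.sum_congr rfl fun p hp => if_pos hp]
    simp [hc.ne']
  · dsimp only
    rw [if_pos hp]
    positivity

open Classical in
theorem single_mem_closedSimplex {s : Finset P} {v : P} (hv : v ∈ s) :
    (Pi.single v 1 : P → ℝ) ∈ closedSimplex s := by
  refine ⟨fun p => ?_, fun p hp => ?_, ?_⟩
  · by_cases h : p = v
    · subst h; simp
    · simp [h]
  · exact Pi.single_eq_of_ne (by rintro rfl; exact hp hv) _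
  · simp [hv]

open Classical in
theorem single_mem_geometricRealization {v : P} (hv : {v} ∈ K.faces) :
    (Pi.single v 1 : P → ℝ) ∈ geometricRealization K :=
  closedSimplex_subset_geometricRealization hv (single_mem_closedSimplex (by simp))

open Classical in
theorem single_mem_openStar {v : P} (hv : {v} ∈ K.faces) :
    (Pi.single v 1 : P → ℝ) ∈ openStar K v :=
  ⟨single_mem_geometricRealization hv, by simp⟩

theorem singleton_mem_faces_of_mem {s : Finset P} (hs : s ∈ K.faces) {v : P} (hv : v ∈ s) :
    {v} ∈ K.faces :=
  K.mem_faces_of_subset hs (by simpa using hv) (by simp)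

theorem singleton_mem_faces_of_mem_openStar {v : P} {x : P → ℝ} (hx : x ∈ openStar K v) :
    {v} ∈ K.faces := by
  obtain ⟨s, hs, -, hpos⟩ := exists_face_of_pos hx.1
  exact singleton_mem_faces_of_mem hs (hpos v hx.2)

open Classical in
theorem starConvex_openStar (v : P) : StarConvex ℝ (Pi.single v 1 : P → ℝ) (openStar K v) := by
  intro x hx a b ha hb hab
  obtain ⟨s, hs, hxs, hpos⟩ := exists_face_of_pos hx.1
  refine ⟨closedSimplex_subset_geometricRealization hs (convex_closedSimplex s
    (single_mem_closedSimplex (hpos v hx.2)) hxs ha hb hab), ?_⟩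
  have := hx.2
  simp only [Pi.add_apply, Pi.smul_apply, Pi.single_eq_same, smul_eq_mul, mul_one]
  rcases ha.eq_or_lt with rfl | ha
  · obtain rfl : b = 1 := by simpa using hab
    simpa
  · positivity

theorem isOpen_openStar (v : P) :
    IsOpen {x : geometricRealization K | (x : P → ℝ) ∈ openStar K v} := by
  have : {x : geometricRealization K | (x : P → ℝ) ∈ openStar K v} =
      {x : geometricRealization K | 0 < (x : P → ℝ) v} := by
    ext x
    exact ⟨fun h => h.2, fun h => ⟨x.2, h⟩⟩
  rw [this]
  exact isOpen_lt continuous_const ((continuous_apply v).comp continuous_subtype_val)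

theorem isPathConnected_preimage_val {E : Type*} [TopologicalSpace E] {X A : Set E} (hAX : A ⊆ X)
    (hA : IsPathConnected A) : IsPathConnected {x : X | (x : E) ∈ A} := by
  rw [IsInducing.subtypeVal.isPathConnected_iff]
  convert! hA using 1
  ext x
  simpa using fun h => hAX h

theorem isPathConnected_openStar {v : P} (hv : {v} ∈ K.faces) :
    IsPathConnected {x : geometricRealization K | (x : P → ℝ) ∈ openStar K v} :=
  isPathConnected_preimage_val (fun _ hx => hx.1)
    ((starConvex_openStar v).isPathConnected (single_mem_openStar hv))

theorem locallyPathConnectedSpace_geometricRealization [Finite P] :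
    LocallyPathConnectedSpace (geometricRealization K) := by
  classical
  have := Fintype.ofFinite P
  let U (x : geometricRealization K) : Set (geometricRealization K) :=
    {y | ∀ p, 0 < (x : P → ℝ) p → 0 < (y : P → ℝ) p}
  have hU (x) : U x ∈ 𝓝 x := by
    have : U x = ⋂ p, {y : geometricRealization K | 0 < (x : P → ℝ) p → 0 < (y : P → ℝ) p} := by
      ext; simp [U]
    rw [this, Filter.iInter_mem]
    intro p
    by_cases hp : 0 < (x : P → ℝ) p
    · simp only [hp, true_imp_iff]
      exact (isOpen_lt continuous_const
        ((continuous_apply p).comp continuous_subtype_val)).mem_nhds hp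
    · simp [hp]
  have hbasis (x) : (𝓝 x).HasBasis (fun ε : ℝ => 0 < ε) (fun ε => U x ∩ Metric.ball x ε) := by
    rw [← inf_eq_right.2 (Filter.le_principal_iff.2 (hU x))]
    exact Metric.nhds_basis_ball.principal_inf _
  refine .of_bases hbasis fun x ε hε => ?_
  let A : Set (P → ℝ) := {y | y ∈ geometricRealization K ∧
    (∀ p, 0 < (x : P → ℝ) p → 0 < y p) ∧ y ∈ Metric.ball (x : P → ℝ) ε}
  have hxA : (x : P → ℝ) ∈ A := ⟨x.2, fun _ h => h, by simpa⟩
  have hA : StarConvex ℝ (x : P → ℝ) A := by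
    rintro y ⟨hyK, hy, hyε⟩ a b ha hb hab
    obtain ⟨s, hs, hys, hpos⟩ := exists_face_of_pos hyK
    refine ⟨closedSimplex_subset_geometricRealization hs (convex_closedSimplex s ?_ hys ha hb hab),
      fun p hp => ?_, convex_ball _ _ (Metric.mem_ball_self hε) hyε ha hb hab⟩
    · obtain ⟨t, -, hxt, hpost⟩ := exists_carrier x.2
      have hts : t ⊆ s := fun p hp => hpos p (hy p ((hpost p).1 hp))
      refine ⟨hxt.1, fun p hp => hxt.2.1 p fun h => hp (hts h), ?_⟩
      rw [← hxt.2.2]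
      exact (Finset.sum_subset hts fun p _ hp => hxt.2.1 p hp).symm
    · have := hy p hp
      simp only [Pi.add_apply, Pi.smul_apply, smul_eq_mul]
      rcases ha.eq_or_lt with rfl | ha
      · obtain rfl : b = 1 := by simpa using hab
        simpa
      · positivity
  convert! isPathConnected_preimage_val (X := geometricRealization K) (fun y hy => hy.1)
    (hA.isPathConnected hxA) using 1
  ext y
  simp [U, A, Subtype.dist_eq]

/-! ### Connectedness -/

/-- A complex is edge-connected if it has a vertex and each predicate on vertices that is constant
on faces is constant. -/
def EdgeConnected (K : PreAbstractSimplicialComplex P) : Prop :=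
  (∃ v, {v} ∈ K.faces) ∧ ∀ f : P → Prop, (∀ s ∈ K.faces, ∀ p ∈ s, ∀ q ∈ s, f p → f q) →
    ∀ p q, {p} ∈ K.faces → {q} ∈ K.faces → f p → f q

theorem edgeConnected_of_connectedSpace [hK : ConnectedSpace (geometricRealization K)] :
    EdgeConnected K := by
  constructor
  · obtain ⟨x⟩ := hK.toNonempty
    obtain ⟨p, hp⟩ := exists_pos_of_mem_geometricRealization x.2
    exact ⟨p, singleton_mem_faces_of_mem_openStar ⟨x.2, hp⟩⟩
  · classical
    intro f hf p q hp hq hfp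
    by_contra hfq
    let W (g : P → Prop) : Set (geometricRealization K) :=
      ⋃ v, ⋃ _ : g v, {x | (x : P → ℝ) ∈ openStar K v}
    have hW (g) : IsOpen (W g) := isOpen_iUnion fun v => isOpen_iUnion fun _ => isOpen_openStar v
    have hcover : univ ⊆ W f ∪ W (fun v => ¬ f v) := by
      intro x _
      obtain ⟨v, hv⟩ := exists_pos_of_mem_geometricRealization x.2
      by_cases h : f v
      · exact Or.inl (mem_iUnion₂.2 ⟨v, h, x.2, hv⟩)
      · exact Or.inr (mem_iUnion₂.2 ⟨v, h, x.2, hv⟩)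
    obtain ⟨x, -, hx1, hx2⟩ := isPreconnected_univ (α := geometricRealization K) _ _ (hW f)
      (hW fun v => ¬ f v) hcover
      ⟨⟨_, single_mem_geometricRealization hp⟩, trivial,
        mem_iUnion₂.2 ⟨p, hfp, single_mem_openStar hp⟩⟩
      ⟨⟨_, single_mem_geometricRealization hq⟩, trivial,
        mem_iUnion₂.2 ⟨q, hfq, single_mem_openStar hq⟩⟩
    obtain ⟨v, hv, hxv⟩ := mem_iUnion₂.1 hx1
    obtain ⟨w, hw, hxw⟩ := mem_iUnion₂.1 hx2
    obtain ⟨s, hs, -, hpos⟩ := exists_face_of_pos x.2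
    exact hw (hf s hs v (hpos v hxv.2) w (hpos w hxw.2) hv)

theorem joined_of_mem_starConvex {A : Set (P → ℝ)} {a : P → ℝ} (hA : A ⊆ geometricRealization K)
    (haA : a ∈ A) (hstar : StarConvex ℝ a A) {x y : geometricRealization K}
    (hx : (x : P → ℝ) ∈ A) (hy : (y : P → ℝ) ∈ A) :
    ∃ γ : Path x y, ∀ t, (γ t : P → ℝ) ∈ A := by
  obtain ⟨γ, hγ⟩ := (isPathConnected_preimage_val hA (hstar.isPathConnected haA)).joinedIn x hx y hy
  exact ⟨γ, hγ⟩

theorem pathConnectedSpace_of_edgeConnected (h : EdgeConnected K) :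
    PathConnectedSpace (geometricRealization K) := by
  classical
  obtain ⟨⟨v, hv⟩, h⟩ := h
  let x₀ : geometricRealization K := ⟨_, single_mem_geometricRealization hv⟩
  let f (p : P) : Prop := ∀ hp : {p} ∈ K.faces,
    Joined x₀ ⟨_, single_mem_geometricRealization hp⟩
  have hf : ∀ s ∈ K.faces, ∀ p ∈ s, ∀ q ∈ s, f p → f q := by
    intro s hs p hp q hq hfp hq'
    obtain ⟨γ, -⟩ := joined_of_mem_starConvex (closedSimplex_subset_geometricRealization hs)
      (single_mem_closedSimplex hp)
      ((convex_closedSimplex s).starConvex (single_mem_closedSimplex hp))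
      (x := ⟨_, single_mem_geometricRealization (singleton_mem_faces_of_mem hs hp)⟩)
      (y := ⟨_, single_mem_geometricRealization hq'⟩)
      (single_mem_closedSimplex hp) (single_mem_closedSimplex hq)
    exact (hfp (singleton_mem_faces_of_mem hs hp)).trans ⟨γ⟩
  have hx₀ (x : geometricRealization K) : Joined x₀ x := by
    obtain ⟨p, hp⟩ := exists_pos_of_mem_geometricRealization x.2
    have hx : (x : P → ℝ) ∈ openStar K p := ⟨x.2, hp⟩
    have hp' := singleton_mem_faces_of_mem_openStar hx
    obtain ⟨γ, -⟩ := joined_of_mem_starConvex (fun _ hx => hx.1) (single_mem_openStar hp')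
      (starConvex_openStar p) (x := ⟨_, single_mem_geometricRealization hp'⟩)
      (single_mem_openStar hp') hx
    exact (h f hf v p hv hp' (fun _ => Joined.refl _) hp').trans ⟨γ⟩
  exact ⟨⟨x₀⟩, fun x y => (hx₀ x).symm.trans (hx₀ y)⟩

theorem connectedSpace_geometricRealization_iff :
    ConnectedSpace (geometricRealization K) ↔ EdgeConnected K :=
  ⟨fun _ => edgeConnected_of_connectedSpace, fun h =>
    have := pathConnectedSpace_of_edgeConnected h
    inferInstance⟩

end Realization

section Cocycles

open Set Topology CategoryTheory

variable {P : Type*} {K : PreAbstractSimplicialComplex P}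

/-- A group-valued function on pairs of vertices is a cocycle if it is multiplicative
on the triples of vertices of each face. -/
def IsEdgeCocycle (K : PreAbstractSimplicialComplex P) {G : Type*} [Group G] (c : P → P → G) :
    Prop :=
  ∀ s ∈ K.faces, ∀ p ∈ s, ∀ q ∈ s, ∀ r ∈ s, c p q * c q r = c p r

/-- A cocycle is a coboundary if it is a quotient of values of a function on the vertices. -/
def IsEdgeCoboundary (K : PreAbstractSimplicialComplex P) {G : Type*} [Group G] (c : P → P → G) :
    Prop :=
  ∃ f : P → G, ∀ s ∈ K.faces, ∀ p ∈ s, ∀ q ∈ s, c p q = (f p)⁻¹ * f q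

theorem IsEdgeCocycle.self_eq_one {G : Type*} [Group G] {c : P → P → G} (hc : IsEdgeCocycle K c)
    {s : Finset P} (hs : s ∈ K.faces) {p : P} (hp : p ∈ s) : c p p = 1 := by
  simpa using hc s hs p hp p hp p hp

/-- The bundle over the geometric realization with discrete fibres defined by a cocycle. -/
noncomputable def cocycleBundleCore {G : Type*} [Group G] [TopologicalSpace G]
    [DiscreteTopology G] (c : P → P → G) (hc : IsEdgeCocycle K c) :
    FiberBundleCore P (geometricRealization K) G where
  baseSet v := {x | (x : P → ℝ) ∈ openStar K v}
  isOpen_baseSet := isOpen_openStar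
  indexAt x := (exists_pos_of_mem_geometricRealization x.2).choose
  mem_baseSet_at x := ⟨x.2, (exists_pos_of_mem_geometricRealization x.2).choose_spec⟩
  coordChange i j _ g := g * c i j
  coordChange_self i x hx g := by
    obtain ⟨s, hs, -, hpos⟩ := exists_face_of_pos x.2
    rw [hc.self_eq_one hs (hpos i hx.2), mul_one]
  continuousOn_coordChange i j :=
    ((continuous_of_discreteTopology (f := fun g : G => g * c i j)).comp
      continuous_snd).continuousOn
  coordChange_comp i j k x hx g := by
    obtain ⟨s, hs, -, hpos⟩ := exists_face_of_pos x.2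
    rw [mul_assoc, hc s hs i (hpos i hx.1.1.2) j (hpos j hx.1.2.2) k (hpos k hx.2.2)]

theorem IsEdgeCocycle.isEdgeCoboundary [Finite P] [SimplyConnectedSpace (geometricRealization K)]
    {G : Type*} [Group G] {c : P → P → G} (hc : IsEdgeCocycle K c) : IsEdgeCoboundary K c := by
  classical
  let _ : TopologicalSpace G := ⊥
  have : DiscreteTopology G := ⟨rfl⟩
  have := locallyPathConnectedSpace_geometricRealization (K := K)
  let Z := cocycleBundleCore c hc
  have hcov : IsCoveringMap Z.proj := FiberBundle.isCoveringMap
  let a₀ : geometricRealization K := Classical.arbitrary _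
  obtain ⟨F, ⟨-, hF⟩, -⟩ := hcov.existsUnique_continuousMap_lifts (ContinuousMap.id _) a₀
    (⟨a₀, (1 : G)⟩ : Z.TotalSpace) rfl
  have hF1 (x) : (F x).1 = x := congrFun hF x
  let g (i : P) (x : geometricRealization K) : G := (Z.localTriv i (F x)).2
  let φ (x : geometricRealization K) : G := (F x).2
  have hg (i x) : g i x = φ x * c (Z.indexAt (F x).1) i := rfl
  have hgcont (i) : ContinuousOn (g i) {x | (x : P → ℝ) ∈ openStar K i} := by
    refine continuous_snd.comp_continuousOn ((Z.localTriv i).continuousOn.comp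
      F.continuous.continuousOn fun x hx => ?_)
    rw [Z.mem_localTriv_source]
    exact (hF1 x).symm ▸ hx
  have hgmul (i j) (x : geometricRealization K) (hi : (x : P → ℝ) ∈ openStar K i)
      (hj : (x : P → ℝ) ∈ openStar K j) :
      g i x * c i j = g j x := by
    obtain ⟨s, hs, -, hpos⟩ := exists_face_of_pos x.2
    have hmem := Z.mem_baseSet_at (F x).1
    rw [hg, hg, mul_assoc, hc s hs _ (hpos _ ?_) i (hpos i hi.2) j (hpos j hj.2)]
    have h2 := hmem.2
    rwa [hF1 x] at h2 ⊢
  have hconst (i) (x y : geometricRealization K) (hx : (x : P → ℝ) ∈ openStar K i)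
      (hy : (y : P → ℝ) ∈ openStar K i) :
      g i x = g i y :=
    (isPathConnected_openStar
      (singleton_mem_faces_of_mem_openStar hx)).isConnected.isPreconnected.constant
      (hgcont i) hx hy
  refine ⟨fun p => if hp : {p} ∈ K.faces then g p ⟨_, single_mem_geometricRealization hp⟩ else 1,
    fun s hs p hp q hq => ?_⟩
  have hp' := singleton_mem_faces_of_mem hs hp
  have hq' := singleton_mem_faces_of_mem hs hq
  obtain ⟨x, hx, hpos⟩ := exists_forall_pos_of_mem_faces hs
  simp only [dif_pos hp', dif_pos hq']
  rw [hconst p _ ⟨x, hx⟩ (single_mem_openStar hp') ⟨hx, hpos p hp⟩,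
    hconst q _ ⟨x, hx⟩ (single_mem_openStar hq') ⟨hx, hpos q hq⟩,
    ← hgmul p q ⟨x, hx⟩ ⟨hx, hpos p hp⟩ ⟨hx, hpos q hq⟩, inv_mul_cancel_left]

/-- A choice of morphisms of the fundamental groupoid that is compatible with the short paths is
compatible with all paths. -/
theorem comp_fromPath_eq_of_openCover {X ι : Type*} [TopologicalSpace X] {U : ι → Set X}
    (hU : ∀ i, IsOpen (U i)) (hcover : ∀ x, ∃ i, x ∈ U i) {b : FundamentalGroupoid X}
    (δ : ∀ x : X, b ⟶ FundamentalGroupoid.mk x)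
    (hδ : ∀ i (x y : X) (γ : Path x y), (∀ t, γ t ∈ U i) →
      δ x ≫ FundamentalGroupoid.fromPath (Path.Homotopic.Quotient.mk γ) = δ y)
    {x y : X} (γ : Path x y) :
    δ x ≫ FundamentalGroupoid.fromPath (Path.Homotopic.Quotient.mk γ) = δ y := by
  obtain ⟨t, ht0, htmono, ⟨n, hn⟩, ht⟩ := exists_monotone_Icc_subset_open_cover_unitInterval
    (fun i => (hU i).preimage γ.continuous)
    fun s _ => mem_iUnion.2 (hcover (γ s))
  have key (k : ℕ) : δ (γ (t 0)) ≫ FundamentalGroupoid.fromPath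
      (Path.Homotopic.Quotient.mk (γ.subpath (t 0) (t k))) = δ (γ (t k)) := by
    induction k with
    | zero =>
      rw [Path.subpath_self]
      exact Category.comp_id _
    | succ k ih =>
      obtain ⟨i, hi⟩ := ht k
      have hstep := hδ i _ _ (γ.subpath (t k) (t (k + 1))) fun s => by
        have : γ.subpath (t k) (t (k + 1)) s ∈ range (γ.subpath (t k) (t (k + 1))) := ⟨s, rfl⟩
        rw [Path.range_subpath_of_le _ _ _ (htmono k.le_succ)] at this
        obtain ⟨r, hr, hrs⟩ := this
        exact hrs ▸ hi hr
      rw [← hstep, ← ih, Category.assoc]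
      congr 1
      exact ((FundamentalGroupoid.fromPath_eq_iff_homotopic _ _).2
        ⟨Path.Homotopy.subpathTransSubpath γ (t 0) (t k) (t (k + 1))⟩).symm
  have h := key n
  rw [ht0, hn n le_rfl] at h
  rw [Path.subpath_zero_one] at h
  have cast_eq : ∀ (x' y' : X) (hx : x' = x) (hy : y' = y),
      δ x' ≫ FundamentalGroupoid.fromPath (Path.Homotopic.Quotient.mk (γ.cast hx hy)) = δ y' →
      δ x ≫ FundamentalGroupoid.fromPath (Path.Homotopic.Quotient.mk γ) = δ y := by
    rintro _ _ rfl rfl h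
    exact h
  exact cast_eq _ _ γ.source γ.target h

theorem homotopic_of_mem_starConvex {A : Set (P → ℝ)} {a : P → ℝ}
    (hA : A ⊆ geometricRealization K) (hne : A.Nonempty) (hstar : StarConvex ℝ a A)
    {x y : geometricRealization K}
    (γ γ' : Path x y) (hγ : ∀ t, (γ t : P → ℝ) ∈ A) (hγ' : ∀ t, (γ' t : P → ℝ) ∈ A) :
    γ.Homotopic γ' := by
  have := hstar.contractibleSpace hne
  have hx : (x : P → ℝ) ∈ A := by simpa using hγ 0
  have hy : (y : P → ℝ) ∈ A := by simpa using hγ 1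
  let lift (η : Path x y) (hη : ∀ t, (η t : P → ℝ) ∈ A) : Path (⟨x, hx⟩ : A) ⟨y, hy⟩ :=
    { toFun := fun t => ⟨η t, hη t⟩
      continuous_toFun := by fun_prop
      source' := by simp
      target' := by simp }
  let incl : C(A, geometricRealization K) := ⟨inclusion hA, continuous_inclusion hA⟩
  exact (SimplyConnectedSpace.paths_homotopic (lift γ hγ) (lift γ' hγ')).map incl

/-- Classes of straight line paths. -/
theorem exists_segment_class [PathConnectedSpace (geometricRealization K)] :
    ∃ seg : ∀ x y : geometricRealization K, FundamentalGroupoid.mk x ⟶ FundamentalGroupoid.mk y,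
      ∀ (A : Set (P → ℝ)) (a : P → ℝ), A ⊆ geometricRealization K → StarConvex ℝ a A →
        ∀ x y : geometricRealization K, segment ℝ (x : P → ℝ) y ⊆ A →
          ∀ γ : Path x y, (∀ t, (γ t : P → ℝ) ∈ A) →
            FundamentalGroupoid.fromPath (Path.Homotopic.Quotient.mk γ) = seg x y := by
  have h (x y : geometricRealization K) : ∃ γ : Path x y,
      segment ℝ (x : P → ℝ) y ⊆ geometricRealization K →
        ∀ t, (γ t : P → ℝ) ∈ segment ℝ (x : P → ℝ) y := by
    by_cases hxy : segment ℝ (x : P → ℝ) y ⊆ geometricRealization K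
    · obtain ⟨γ, hγ⟩ := joined_of_mem_starConvex hxy (left_mem_segment ℝ _ _)
        ((convex_segment (x : P → ℝ) (y : P → ℝ)).starConvex (left_mem_segment ℝ _ _))
        (left_mem_segment ℝ (x : P → ℝ) y) (right_mem_segment ℝ (x : P → ℝ) y)
      exact ⟨γ, fun _ => hγ⟩
    · exact ⟨PathConnectedSpace.somePath x y, fun h => absurd h hxy⟩
  choose η hη using h
  refine ⟨fun x y => FundamentalGroupoid.fromPath (Path.Homotopic.Quotient.mk (η x y)),
    fun A a hA hstar x y hxy γ hγ => ?_⟩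
  rw [FundamentalGroupoid.fromPath_eq_iff_homotopic]
  exact homotopic_of_mem_starConvex hA ⟨_, hγ 0⟩ hstar _ _ hγ
    fun t => hxy (hη x y (hxy.trans hA) t)

theorem simplyConnectedSpace_of_cocycles {P : Type*} {K : PreAbstractSimplicialComplex P}
    (hconn : EdgeConnected K)
    (hK : ∀ (b : FundamentalGroupoid (geometricRealization K)) (c : P → P → (b ⟶ b)),
      IsEdgeCocycle K c → IsEdgeCoboundary K c) :
    SimplyConnectedSpace (geometricRealization K) := by
  classical
  have hpc := pathConnectedSpace_of_edgeConnected hconn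
  obtain ⟨seg, hseg⟩ := exists_segment_class (K := K)
  let x₀ : geometricRealization K := Classical.arbitrary _
  obtain ⟨vtx, hvtx⟩ : ∃ vtx : P → geometricRealization K,
      ∀ p, {p} ∈ K.faces → (vtx p : P → ℝ) = Pi.single p 1 :=
    ⟨fun p => if hp : {p} ∈ K.faces then ⟨_, single_mem_geometricRealization hp⟩ else x₀,
      fun p hp => by simp [hp]⟩
  have seg_comp (s) (hs : s ∈ K.faces) (x y z : geometricRealization K)
      (hx : (x : P → ℝ) ∈ closedSimplex s) (hy : (y : P → ℝ) ∈ closedSimplex s)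
      (hz : (z : P → ℝ) ∈ closedSimplex s) : seg x y ≫ seg y z = seg x z := by
    have hsub := closedSimplex_subset_geometricRealization hs
    have hconv := convex_closedSimplex s
    have hstar := hconv.starConvex hx
    obtain ⟨γ₁, hγ₁⟩ := joined_of_mem_starConvex hsub hx hstar hx hy
    obtain ⟨γ₂, hγ₂⟩ := joined_of_mem_starConvex hsub hx hstar hy hz
    rw [← hseg _ _ hsub hstar x y (hconv.segment_subset hx hy) γ₁ hγ₁,
      ← hseg _ _ hsub hstar y z (hconv.segment_subset hy hz) γ₂ hγ₂,
      ← hseg _ _ hsub hstar x z (hconv.segment_subset hx hz) (γ₁.trans γ₂) fun t => ?_]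
    · rfl
    · rw [Path.trans_apply]
      split_ifs
      exacts [hγ₁ _, hγ₂ _]
  have seg_path (v) (x y : geometricRealization K) (γ : Path x y)
      (hγ : ∀ t, (γ t : P → ℝ) ∈ openStar K v) :
      seg (vtx v) x ≫ FundamentalGroupoid.fromPath (Path.Homotopic.Quotient.mk γ) =
        seg (vtx v) y := by
    have hsub : openStar K v ⊆ geometricRealization K := fun x hx => hx.1
    have hx : (x : P → ℝ) ∈ openStar K v := by simpa using hγ 0
    have hy : (y : P → ℝ) ∈ openStar K v := by simpa using hγ 1
    have hv' := singleton_mem_faces_of_mem_openStar hx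
    have hv : (vtx v : P → ℝ) ∈ openStar K v := by
      rw [hvtx v hv']
      exact single_mem_openStar hv'
    have hstar : StarConvex ℝ (vtx v : P → ℝ) (openStar K v) := by
      rw [hvtx v hv']
      exact starConvex_openStar v
    obtain ⟨γ₁, hγ₁⟩ := joined_of_mem_starConvex hsub hv hstar hv hx
    rw [← hseg _ _ hsub hstar _ x (hstar.segment_subset hx) γ₁ hγ₁,
      ← hseg _ _ hsub hstar _ y (hstar.segment_subset hy) (γ₁.trans γ) fun t => ?_]
    · rfl
    · rw [Path.trans_apply]
      split_ifs
      exacts [hγ₁ _, hγ _]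
  have hmem (s) (hs : s ∈ K.faces) (p) (hp : p ∈ s) : (vtx p : P → ℝ) ∈ closedSimplex s := by
    rw [hvtx p (singleton_mem_faces_of_mem hs hp)]
    exact single_mem_closedSimplex hp
  let base (x : geometricRealization K) : FundamentalGroupoid.mk x₀ ⟶ FundamentalGroupoid.mk x :=
    FundamentalGroupoid.fromPath (Path.Homotopic.Quotient.mk (PathConnectedSpace.somePath x₀ x))
  let c (p q : P) : FundamentalGroupoid.mk x₀ ⟶ FundamentalGroupoid.mk x₀ :=
    base (vtx p) ≫ seg (vtx p) (vtx q) ≫ inv (base (vtx q))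
  obtain ⟨f, hf⟩ := hK _ c fun s hs p hp q hq r hr => by
    change c p q ≫ c q r = c p r
    simp only [c, Category.assoc, IsIso.inv_hom_id_assoc]
    rw [← seg_comp s hs _ _ _ (hmem s hs p hp) (hmem s hs q hq) (hmem s hs r hr), Category.assoc]
  have hδ (x : geometricRealization K) (v w : P) (hv : (x : P → ℝ) ∈ openStar K v)
      (hw : (x : P → ℝ) ∈ openStar K w) :
      f v ≫ base (vtx v) ≫ seg (vtx v) x = f w ≫ base (vtx w) ≫ seg (vtx w) x := by
    obtain ⟨s, hs, hxs, hpos⟩ := exists_face_of_pos x.2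
    have hcvw : f v ≫ c v w = f w := by
      rw [hf s hs v (hpos v hv.2) w (hpos w hw.2)]
      exact mul_inv_cancel_left (f v) (f w)
    rw [← hcvw, ← seg_comp s hs (vtx v) (vtx w) x (hmem s hs v (hpos v hv.2))
      (hmem s hs w (hpos w hw.2)) hxs]
    simp [c]
  choose v hv using fun x : geometricRealization K => exists_pos_of_mem_geometricRealization x.2
  have key {x y : geometricRealization K} (γ : Path x y) :=
    comp_fromPath_eq_of_openCover
      (U := fun v => {x : geometricRealization K | (x : P → ℝ) ∈ openStar K v})
      isOpen_openStar (fun x => ⟨v x, x.2, hv x⟩)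
      (fun x => f (v x) ≫ base (vtx (v x)) ≫ seg (vtx (v x)) x)
      (fun w x y γ hγ => by
        rw [hδ x (v x) w ⟨x.2, hv x⟩ (by simpa using hγ 0),
          hδ y (v y) w ⟨y.2, hv y⟩ (by simpa using hγ 1), ← seg_path w x y γ hγ]
        simp) γ
  rw [simply_connected_iff_paths_homotopic']
  refine ⟨hpc, fun {x y} γ γ' => ?_⟩
  rw [← FundamentalGroupoid.fromPath_eq_iff_homotopic]
  exact (cancel_epi _).1 ((key γ).trans (key γ').symm)

end Cocycles

section MorseComplexes

variable {V : Type*} {Δ : PreAbstractSimplicialComplex V}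

namespace PrimitiveVectorField

theorem Compatible.symm {p q : PrimitiveVectorField Δ} (h : p.Compatible q) : q.Compatible p :=
  ⟨h.1.symm, h.2.2.1.symm, h.2.1.symm, h.2.2.2.symm⟩

theorem lower_subset_upper (p : PrimitiveVectorField Δ) : p.lower ⊆ p.upper :=
  p.lower_ssubset_upper.1

theorem compatible_of_mem {p q : PrimitiveVectorField Δ} {x : V} (hp : x ∈ p.lower)
    (hq : x ∉ q.upper) : p.Compatible q := by
  have hp' := p.lower_subset_upper hp
  have hq' : x ∉ q.lower := fun h => hq (q.lower_subset_upper h)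
  exact ⟨fun h => hq' (h ▸ hp), fun h => hq (h ▸ hp), fun h => hq' (h ▸ hp'),
    fun h => hq (h ▸ hp')⟩

/-- `q` can follow `p` in a path of a vector field. -/
def Precedes (p q : PrimitiveVectorField Δ) : Prop :=
  q.lower.card = p.lower.card ∧ p.lower ≠ q.lower ∧ q.lower ⊆ p.upper

theorem Precedes.ne {p q : PrimitiveVectorField Δ} (h : p.Precedes q) : p ≠ q := by
  rintro rfl
  exact h.2.1 rfl

open Classical in
theorem Precedes.upper_eq {p q : PrimitiveVectorField Δ} (h : p.Precedes q) :
    p.upper = p.lower ∪ q.lower := by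
  symm
  refine Finset.eq_of_subset_of_card_le (Finset.union_subset p.lower_subset_upper h.2.2) ?_
  rw [p.card_upper, Nat.succ_le_iff]
  refine Finset.card_lt_card ⟨Finset.subset_union_left, fun hsub => h.2.1 ?_⟩
  exact (Finset.eq_of_subset_of_card_le (Finset.subset_union_right.trans hsub) h.1.ge).symm

theorem Precedes.not_symm {p q : PrimitiveVectorField Δ} (hpq : p.Compatible q)
    (h : p.Precedes q) : ¬ q.Precedes p := by
  classical
  intro h'
  exact hpq.2.2.2 (by rw [h.upper_eq, h'.upper_eq, Finset.union_comm])

/-- Three primitive vector fields that form a cycle. -/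
def IsThreeCycle (u v w : PrimitiveVectorField Δ) : Prop :=
  u.Precedes v ∧ v.Precedes w ∧ w.Precedes u

theorem IsThreeCycle.rotate {u v w : PrimitiveVectorField Δ} (h : IsThreeCycle u v w) :
    IsThreeCycle v w u :=
  ⟨h.2.1, h.2.2, h.1⟩

theorem IsThreeCycle.inter_subset {u v w : PrimitiveVectorField Δ} (h : IsThreeCycle u v w)
    (hvw : v.Compatible w) {x : V} (hu : x ∈ u.lower) (hv : x ∈ v.lower) : x ∈ w.lower := by
  classical
  by_contra hx
  have h1 : insert x w.lower ⊆ v.upper :=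
    Finset.insert_subset (v.lower_subset_upper hv) h.2.1.2.2
  have h2 : insert x w.lower ⊆ w.upper :=
    Finset.insert_subset (h.2.2.2.2 hu) w.lower_subset_upper
  have hcard := Finset.card_insert_of_notMem hx
  have e1 := Finset.eq_of_subset_of_card_le h1 (by rw [hcard, v.card_upper, h.2.1.1])
  have e2 := Finset.eq_of_subset_of_card_le h2 (by rw [hcard, w.card_upper])
  exact hvw.2.2.2 (e1.symm.trans e2)

open Classical in
theorem IsThreeCycle.lower_eq {u v w : PrimitiveVectorField Δ} (h : IsThreeCycle u v w)
    (hvw : v.Compatible w) : w.lower = (u.lower ∩ v.lower) ∪ (v.upper \ v.lower) := by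
  symm
  refine Finset.eq_of_subset_of_card_le (Finset.union_subset (fun x hx => ?_) ?_) ?_
  · rw [Finset.mem_inter] at hx
    exact h.inter_subset hvw hx.1 hx.2
  · intro x hx
    rw [h.2.1.upper_eq] at hx
    simp only [Finset.mem_sdiff, Finset.mem_union] at hx
    tauto
  · have h1 := Finset.card_union_add_card_inter u.lower v.lower
    rw [← h.1.upper_eq, u.card_upper] at h1
    have h2 := Finset.card_sdiff_of_subset v.lower_subset_upper
    rw [v.card_upper] at h2
    rw [Finset.card_union_of_disjoint]
    · have := h.1.1
      have := h.2.1.1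
      lia
    · rw [Finset.disjoint_left]
      simp +contextual

end PrimitiveVectorField

open PrimitiveVectorField

/-- A discrete vector field that is not acyclic contains a path of length three without
repetition. -/
theorem IsDiscreteVectorField.exists_precedes {W : Finset (PrimitiveVectorField Δ)}
    (hW : IsDiscreteVectorField W) (hcyc : ¬ IsAcyclicVectorField W) :
    ∃ u ∈ W, ∃ v ∈ W, ∃ w ∈ W, ∃ x ∈ W, u.Precedes v ∧ v.Precedes w ∧ w.Precedes x ∧
      u ≠ v ∧ u ≠ w ∧ v ≠ w ∧ x ≠ v ∧ x ≠ w := by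
  obtain ⟨m, σ, τ, ⟨d, hσ, -, hstep⟩, hm, hclosed⟩ := not_not.1 hcyc
  have hnext (p : PrimitiveVectorField Δ) (hp : ∃ i < m, p.lower = σ i ∧ p.upper = τ i) :
      ∃ q ∈ W, p.Precedes q ∧ ∃ i < m, q.lower = σ i ∧ q.upper = τ i := by
    obtain ⟨i, hi, hl, hu⟩ := hp
    obtain ⟨j, hj, hji⟩ : ∃ j < m, σ j = σ (i + 1) := by
      rcases (Nat.succ_le_of_lt hi).lt_or_eq with h | h
      · exact ⟨i + 1, h, rfl⟩
      · exact ⟨0, hm, by rw [← hclosed, ← h]⟩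
    obtain ⟨⟨q, hq, hql, hqu⟩, -⟩ := hstep j hj
    obtain ⟨-, hsub, hne⟩ := hstep i hi
    refine ⟨q, hq, ⟨?_, ?_, ?_⟩, j, hj, hql, hqu⟩
    · rw [hql, hl, (hσ i hi.le).2, (hσ j hj.le).2]
    · rw [hql, hl, hji]
      exact hne.symm
    · rw [hql, hu, hji]
      exact hsub.1
  obtain ⟨⟨u, hu, hul, huu⟩, -⟩ := hstep 0 hm
  obtain ⟨v, hv, huv, hv'⟩ := hnext u ⟨0, hm, hul, huu⟩
  obtain ⟨w, hw, hvw, hw'⟩ := hnext v hv'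
  obtain ⟨x, hx, hwx, -⟩ := hnext w hw'
  refine ⟨u, hu, v, hv, w, hw, x, hx, huv, hvw, hwx, huv.ne, ?_, hvw.ne, ?_, hwx.ne.symm⟩
  · rintro rfl
    exact huv.not_symm (hW _ hu _ hv huv.ne) hvw
  · rintro rfl
    exact hvw.not_symm (hW _ hx _ hw hvw.ne) hwx

theorem mem_faces_morseComplex_of_card_le_two {W : Finset (PrimitiveVectorField Δ)}
    (hW : W ∈ (generalizedMorseComplex Δ).faces) (hcard : W.card ≤ 2) :
    W ∈ (morseComplex Δ).faces := by
  classical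
  refine ⟨hW, by_contra fun h => ?_⟩
  obtain ⟨u, hu, v, hv, w, hw, -, -, -, -, -, huv, huw, hvw, -⟩ := hW.2.exists_precedes h
  have hsub : ({u, v, w} : Finset _) ⊆ W := by simp [Finset.insert_subset_iff, *]
  have := Finset.card_le_card hsub
  rw [Finset.card_eq_three.2 ⟨u, v, w, huv, huw, hvw, rfl⟩] at this
  lia

open Classical in
theorem exists_isThreeCycle_of_card_le_three {W : Finset (PrimitiveVectorField Δ)}
    (hW : W ∈ (generalizedMorseComplex Δ).faces) (hcard : W.card ≤ 3)
    (hM : W ∉ (morseComplex Δ).faces) :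
    ∃ u v w : PrimitiveVectorField Δ, W = {u, v, w} ∧ IsThreeCycle u v w := by
  obtain ⟨u, hu, v, hv, w, hw, x, hx, huv', hvw', hwx', huv, huw, hvw, hxv, hxw⟩ :=
    hW.2.exists_precedes fun h => hM ⟨hW, h⟩
  have hsub : ({u, v, w} : Finset _) ⊆ W := by simp [Finset.insert_subset_iff, *]
  have heq := Finset.eq_of_subset_of_card_le hsub
    (by rwa [Finset.card_eq_three.2 ⟨u, v, w, huv, huw, hvw, rfl⟩])
  obtain rfl : x = u := by
    rw [← heq] at hx
    simpa [hxv, hxw] using hx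
  exact ⟨x, v, w, heq.symm, huv', hvw', hwx'⟩

theorem morseComplex_faces_subset :
    (morseComplex Δ).faces ⊆ (generalizedMorseComplex Δ).faces := fun _ h => h.1

theorem edgeConnected_morseComplex_iff :
    EdgeConnected (morseComplex Δ) ↔ EdgeConnected (generalizedMorseComplex Δ) := by
  classical
  have hvert (p : PrimitiveVectorField Δ) :
      {p} ∈ (morseComplex Δ).faces ↔ {p} ∈ (generalizedMorseComplex Δ).faces :=
    ⟨fun h => h.1, fun h => mem_faces_morseComplex_of_card_le_two h (by simp)⟩
  have hedge (f : PrimitiveVectorField Δ → Prop) :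
      (∀ s ∈ (morseComplex Δ).faces, ∀ p ∈ s, ∀ q ∈ s, f p → f q) ↔
        ∀ s ∈ (generalizedMorseComplex Δ).faces, ∀ p ∈ s, ∀ q ∈ s, f p → f q := by
    refine ⟨fun h s hs p hp q hq => h {p, q} ?_ p (by simp) q (by simp), fun h s hs => h s hs.1⟩
    refine mem_faces_morseComplex_of_card_le_two
      ((generalizedMorseComplex Δ).mem_faces_of_subset hs ?_ (by simp)) Finset.card_le_two
    simp [Finset.insert_subset_iff, hp, hq]
  simp only [EdgeConnected, hvert, hedge]

open Classical in
theorem PrimitiveVectorField.IsThreeCycle.cone_mem_faces {u v w q : PrimitiveVectorField Δ}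
    (h : IsThreeCycle u v w) (hW : IsDiscreteVectorField {u, v, w}) (hu : q.Compatible u)
    (hv : q.Compatible v) (hw : q.Compatible w) {a b : PrimitiveVectorField Δ}
    (ha : a ∈ ({u, v, w} : Finset _)) (hb : b ∈ ({u, v, w} : Finset _)) : {a, b, q} ∈ (morseComplex Δ).faces := by
  have hq (x) (hx : x ∈ ({u, v, w} : Finset _)) : q.Compatible x := by
    simp only [Finset.mem_insert, Finset.mem_singleton] at hx
    rcases hx with rfl | rfl | rfl <;> assumption
  have hqW : q ∉ ({u, v, w} : Finset _) := fun hmem => (hq q hmem).1 rfl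
  have hface : {a, b, q} ∈ (generalizedMorseComplex Δ).faces := by
    have hsub (x) (hx : x ∈ ({a, b, q} : Finset _)) : x ∈ ({u, v, w} : Finset _) ∨ x = q := by
      simp only [Finset.mem_insert, Finset.mem_singleton] at hx
      rcases hx with rfl | rfl | rfl
      exacts [Or.inl ha, Or.inl hb, Or.inr rfl]
    refine ⟨by simp, fun x hx y hy hxy => ?_⟩
    rcases hsub x hx with hx' | rfl <;> rcases hsub y hy with hy' | rfl
    · exact hW x hx' y hy' hxy
    · exact (hq x hx').symm
    · exact hq y hy'
    · exact absurd rfl hxy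
  -- a three-cycle through `q` would share two elements with the given one
  have hno (u' v' : PrimitiveVectorField Δ) (hu' : u' ∈ ({a, b, q} : Finset _))
      (hv' : v' ∈ ({a, b, q} : Finset _)) (h' : IsThreeCycle u' v' q) : False := by
    have hmem (x) (hx : x ∈ ({a, b, q} : Finset _)) (hxq : x ≠ q) :
        x ∈ ({u, v, w} : Finset _) := by
      simp only [Finset.mem_insert, Finset.mem_singleton] at hx
      rcases hx with rfl | rfl | rfl
      exacts [ha, hb, absurd rfl hxq]
    have hu' := hmem u' hu' h'.2.2.ne.symm
    have hv' := hmem v' hv' h'.2.1.ne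
    have huv := hW u (by simp) v (by simp) h.1.ne
    have hvw := hW v (by simp) w (by simp) h.2.1.ne
    have hwu := hW w (by simp) u (by simp) h.2.2.ne
    have key {a b c : PrimitiveVectorField Δ} (h : IsThreeCycle a b c) (hbc : b.Compatible c)
        (hqb : q.Compatible b) (hqc : q.Compatible c) (h' : IsThreeCycle a b q) : False :=
      hqc.1 ((h'.lower_eq hqb.symm).trans (h.lower_eq hbc).symm)
    simp only [Finset.mem_insert, Finset.mem_singleton] at hu' hv'
    rcases hu' with rfl | rfl | rfl <;> rcases hv' with rfl | rfl | rfl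
    · exact h'.1.ne rfl
    · exact key h hvw hv hw h'
    · exact h.2.2.not_symm hwu h'.1
    · exact h.1.not_symm huv h'.1
    · exact h'.1.ne rfl
    · exact key h.rotate hwu hw hu h'
    · exact key h.rotate.rotate huv hu hv h'
    · exact h.2.1.not_symm hvw h'.1
    · exact h'.1.ne rfl
  by_contra hM
  obtain ⟨u', v', w', heq, h'⟩ :=
    exists_isThreeCycle_of_card_le_three hface Finset.card_le_three hM
  have hmem : q ∈ ({u', v', w'} : Finset _) := heq ▸ (by simp)
  rw [heq] at hno
  simp only [Finset.mem_insert, Finset.mem_singleton] at hmem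
  rcases hmem with rfl | rfl | rfl
  · exact hno v' w' (by simp) (by simp) h'.rotate
  · exact hno w' u' (by simp) (by simp) h'.rotate.rotate
  · exact hno u' v' (by simp) (by simp) h'

open Classical in
/-- If the boundary of each missing triangle of the Morse complex spans a cone, cocycles extend. -/
theorem isEdgeCocycle_generalizedMorseComplex {G : Type*} [Group G]
    {c : PrimitiveVectorField Δ → PrimitiveVectorField Δ → G}
    (hc : IsEdgeCocycle (morseComplex Δ) c)
    (hcone : ∀ u v w : PrimitiveVectorField Δ, IsDiscreteVectorField {u, v, w} →
      IsThreeCycle u v w → ∃ q : PrimitiveVectorField Δ,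
        q.Compatible u ∧ q.Compatible v ∧ q.Compatible w) :
    IsEdgeCocycle (generalizedMorseComplex Δ) c := by
  intro s hs p hp q hq r hr
  have ht : {p, q, r} ∈ (generalizedMorseComplex Δ).faces :=
    (generalizedMorseComplex Δ).mem_faces_of_subset hs
      (by simp [Finset.insert_subset_iff, hp, hq, hr]) (by simp)
  by_cases hM : {p, q, r} ∈ (morseComplex Δ).faces
  · exact hc _ hM p (by simp) q (by simp) r (by simp)
  obtain ⟨u, v, w, heq, hcyc⟩ :=
    exists_isThreeCycle_of_card_le_three ht Finset.card_le_three hM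
  obtain ⟨z, hzu, hzv, hzw⟩ := hcone u v w (heq ▸ ht.2) hcyc
  have hface (a b) (ha : a ∈ ({p, q, r} : Finset _)) (hb : b ∈ ({p, q, r} : Finset _)) :
      {a, b, z} ∈ (morseComplex Δ).faces :=
    hcyc.cone_mem_faces (heq ▸ ht.2) hzu hzv hzw (heq ▸ ha) (heq ▸ hb)
  have hsplit (a b) (ha : a ∈ ({p, q, r} : Finset _)) (hb : b ∈ ({p, q, r} : Finset _)) :
      c a b = c a z * c z b :=
    (hc _ (hface a b ha hb) a (by simp) z (by simp) b (by simp)).symm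
  have hq1 : c z q * c q z = 1 := by
    rw [hc _ (hface q q (by simp) (by simp)) z (by simp) q (by simp) z (by simp),
      hc.self_eq_one (hface q q (by simp) (by simp)) (by simp)]
  rw [hsplit p q (by simp) (by simp), hsplit q r (by simp) (by simp),
    hsplit p r (by simp) (by simp), mul_assoc, ← mul_assoc (c z q), hq1, one_mul]

end MorseComplexes

section MissingTriangles

open PrimitiveVectorField

/-- The pairs of faces of a triangle that form a primitive vector field. -/
def IsTrianglePair (s t : Finset (Fin 3)) : Prop :=
  s.Nonempty ∧ s ⊆ t ∧ t.card = s.card + 1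

instance (s t : Finset (Fin 3)) : Decidable (IsTrianglePair s t) :=
  inferInstanceAs (Decidable (_ ∧ _ ∧ _))

/-- Two pairs of faces of a triangle are equal or disjoint. -/
def TrianglePairsAgree (s t s' t' : Finset (Fin 3)) : Prop :=
  (s = s' ∧ t = t') ∨ (s ≠ s' ∧ s ≠ t' ∧ t ≠ s' ∧ t ≠ t')

instance (s t s' t' : Finset (Fin 3)) : Decidable (TrianglePairsAgree s t s' t') :=
  inferInstanceAs (Decidable (_ ∨ _))

/-- A function on some of the pairs of faces of a triangle. Its coboundary, extended by `1` to the
remaining pairs, is a cocycle on the generalized Morse complex of the triangle. -/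
def triangleLabel (s t : Finset (Fin 3)) : Option (Multiplicative (ZMod 2)) :=
  if t = {0, 2} ∨ s = {0, 1} ∨ s = {1, 2} then none
  else if (s = {1} ∧ t = {0, 1}) ∨ (s = {2} ∧ t = {1, 2}) then some (.ofAdd 1) else some 1

/-- The cocycle given by the labels of the pairs of faces of a triangle. -/
def triangleCocycle (s t s' t' : Finset (Fin 3)) : Multiplicative (ZMod 2) :=
  match triangleLabel s t, triangleLabel s' t' with
  | some a, some b => a * b
  | _, _ => 1

set_option maxRecDepth 100000 in
theorem triangleCocycle_mul : ∀ s₁ t₁ : Finset (Fin 3), IsTrianglePair s₁ t₁ →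
    ∀ s₂ t₂ : Finset (Fin 3), IsTrianglePair s₂ t₂ → TrianglePairsAgree s₁ t₁ s₂ t₂ →
    ∀ s₃ t₃ : Finset (Fin 3), IsTrianglePair s₃ t₃ → TrianglePairsAgree s₁ t₁ s₃ t₃ →
    TrianglePairsAgree s₂ t₂ s₃ t₃ →
    triangleCocycle s₁ t₁ s₂ t₂ * triangleCocycle s₂ t₂ s₃ t₃ =
      triangleCocycle s₁ t₁ s₃ t₃ := by
  decide +kernel

variable {V : Type*} {Δ : PreAbstractSimplicialComplex V}

open Classical in
/-- The pull-back of a set of vertices to the standard triangle. -/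
noncomputable def trianglePreimage (pt : Fin 3 → V) (s : Finset V) : Finset (Fin 3) :=
  Finset.univ.filter (pt · ∈ s)

open Classical in
theorem image_trianglePreimage {pt : Fin 3 → V} {s : Finset V} (hs : ∀ x ∈ s, ∃ i, pt i = x) :
    (trianglePreimage pt s).image pt = s := by
  ext x
  simp only [trianglePreimage, Finset.mem_image, Finset.mem_filter, Finset.mem_univ, true_and]
  exact ⟨by rintro ⟨i, hi, rfl⟩; exact hi, fun hx => by
    obtain ⟨i, rfl⟩ := hs x hx
    exact ⟨i, hx, rfl⟩⟩

/-- The generalized Morse complex of a triangle carries a cocycle that is not a coboundary. -/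
theorem exists_cocycle_of_triangle {pt : Fin 3 → V} (hpt : Function.Injective pt)
    (hΔ : ∀ p : PrimitiveVectorField Δ, ∀ x ∈ p.upper, ∃ i, pt i = x)
    (h01 : (Finset.univ.filter (· ≠ 2)).map ⟨pt, hpt⟩ ∈ Δ.faces)
    (h12 : (Finset.univ.filter (· ≠ 0)).map ⟨pt, hpt⟩ ∈ Δ.faces)
    (h02 : (Finset.univ.filter (· ≠ 1)).map ⟨pt, hpt⟩ ∈ Δ.faces) :
    ∃ c : PrimitiveVectorField Δ → PrimitiveVectorField Δ → Multiplicative (ZMod 2),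
      IsEdgeCocycle (generalizedMorseComplex Δ) c ∧
        ¬ IsEdgeCoboundary (generalizedMorseComplex Δ) c := by
  classical
  let l (p : PrimitiveVectorField Δ) := trianglePreimage pt p.lower
  let u (p : PrimitiveVectorField Δ) := trianglePreimage pt p.upper
  have hl (p : PrimitiveVectorField Δ) : (l p).image pt = p.lower :=
    image_trianglePreimage fun x hx => hΔ p x (p.lower_subset_upper hx)
  have hu (p : PrimitiveVectorField Δ) : (u p).image pt = p.upper := image_trianglePreimage (hΔ p)
  have hpair (p : PrimitiveVectorField Δ) : IsTrianglePair (l p) (u p) := by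
    refine ⟨?_, ?_, ?_⟩
    · rw [← Finset.image_nonempty (f := pt), hl]
      exact (Δ.isRelLowerSet_faces p.lower_mem).1
    · rw [← Finset.image_subset_image_iff hpt, hl, hu]
      exact p.lower_subset_upper
    · rw [← Finset.card_image_of_injective _ hpt, ← Finset.card_image_of_injective (l p) hpt, hl,
        hu, p.card_upper]
  have hagree (s) (hs : s ∈ (generalizedMorseComplex Δ).faces) (p) (hp : p ∈ s) (q) (hq : q ∈ s) :
      TrianglePairsAgree (l p) (u p) (l q) (u q) := by
    by_cases hpq : p = q
    · subst hpq
      exact Or.inl ⟨rfl, rfl⟩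
    · have h := hs.2 p hp q hq hpq
      rw [Compatible, ← hl, ← hl, ← hu, ← hu] at h
      exact Or.inr ⟨fun e => h.1 (by rw [e]), fun e => h.2.1 (by rw [e]),
        fun e => h.2.2.1 (by rw [e]), fun e => h.2.2.2 (by rw [e])⟩
  refine ⟨fun p q => triangleCocycle (l p) (u p) (l q) (u q), fun s hs p hp q hq r hr =>
    triangleCocycle_mul _ _ (hpair p) _ _ (hpair q) (hagree s hs p hp q hq) _ _ (hpair r)
      (hagree s hs p hp r hr) (hagree s hs q hq r hr), ?_⟩
  rintro ⟨f, hf⟩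
  have hmk (s t : Finset (Fin 3)) (hs : s.Nonempty) (hst : s ⊂ t) (hcard : t.card = s.card + 1)
      (ht : t.map ⟨pt, hpt⟩ ∈ Δ.faces) : ∃ p : PrimitiveVectorField Δ, l p = s ∧ u p = t ∧
        p.lower = s.map ⟨pt, hpt⟩ ∧ p.upper = t.map ⟨pt, hpt⟩ := by
    have hsub := Finset.map_ssubset_map (f := ⟨pt, hpt⟩) |>.2 hst
    refine ⟨⟨s.map ⟨pt, hpt⟩, t.map ⟨pt, hpt⟩, Δ.mem_faces_of_subset ht hsub.1 (by simpa), ht,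
      hsub, by simpa⟩, ?_, ?_, rfl, rfl⟩ <;>
    · ext i
      simp [l, u, trianglePreimage]
  obtain ⟨p₁, l₁, u₁, L₁, U₁⟩ := hmk {0} (Finset.univ.filter (· ≠ 2)) (by decide) (by decide)
    (by decide) h01
  obtain ⟨p₂, l₂, u₂, L₂, U₂⟩ := hmk {2} (Finset.univ.filter (· ≠ 0)) (by decide) (by decide)
    (by decide) h12
  obtain ⟨p₃, l₃, u₃, L₃, U₃⟩ := hmk {1} (Finset.univ.filter (· ≠ 2)) (by decide) (by decide)
    (by decide) h01
  obtain ⟨p₄, l₄, u₄, L₄, U₄⟩ := hmk {2} (Finset.univ.filter (· ≠ 1)) (by decide) (by decide)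
    (by decide) h02
  have hface {p q : PrimitiveVectorField Δ} (h : p.Compatible q) :
      {p, q} ∈ (generalizedMorseComplex Δ).faces := by
    refine ⟨by simp, fun x hx y hy hxy => ?_⟩
    simp only [Finset.mem_insert, Finset.mem_singleton] at hx hy
    rcases hx with rfl | rfl <;> rcases hy with rfl | rfl
    exacts [absurd rfl hxy, h, h.symm, absurd rfl hxy]
  have hval {p q : PrimitiveVectorField Δ} (h : p.Compatible q) :=
    hf _ (hface h) p (by simp) q (by simp)
  have h12 := hval (p := p₁) (q := p₂) (by
    simp only [Compatible, L₁, L₂, U₁, U₂, ne_eq, Finset.map_inj]; decide)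
  have h23 := hval (p := p₂) (q := p₃) (by
    simp only [Compatible, L₂, L₃, U₂, U₃, ne_eq, Finset.map_inj]; decide)
  have h34 := hval (p := p₃) (q := p₄) (by
    simp only [Compatible, L₃, L₄, U₃, U₄, ne_eq, Finset.map_inj]; decide)
  have h41 := hval (p := p₄) (q := p₁) (by
    simp only [Compatible, L₄, L₁, U₄, U₁, ne_eq, Finset.map_inj]; decide)
  simp only [l₁, l₂, l₃, l₄, u₁, u₂, u₃, u₄] at h12 h23 h34 h41
  have hprod : triangleCocycle {0} (Finset.univ.filter (· ≠ 2)) {2} (Finset.univ.filter (· ≠ 0)) *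
      triangleCocycle {2} (Finset.univ.filter (· ≠ 0)) {1} (Finset.univ.filter (· ≠ 2)) *
      triangleCocycle {1} (Finset.univ.filter (· ≠ 2)) {2} (Finset.univ.filter (· ≠ 1)) *
      triangleCocycle {2} (Finset.univ.filter (· ≠ 1)) {0} (Finset.univ.filter (· ≠ 2)) = 1 := by
    rw [h12, h23, h34, h41]
    group
  revert hprod
  decide

/-- A missing triangle of the Morse complex is the base of a cone, unless the generalized Morse
complex carries a cocycle that is not a coboundary. -/
theorem PrimitiveVectorField.IsThreeCycle.exists_compatible
    (hcob : ∀ c : PrimitiveVectorField Δ → PrimitiveVectorField Δ → Multiplicative (ZMod 2),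
      IsEdgeCocycle (generalizedMorseComplex Δ) c →
        IsEdgeCoboundary (generalizedMorseComplex Δ) c)
    {u v w : PrimitiveVectorField Δ} (hvw : v.Compatible w) (h : IsThreeCycle u v w) :
    ∃ q : PrimitiveVectorField Δ, q.Compatible u ∧ q.Compatible v ∧ q.Compatible w := by
  classical
  rcases Nat.lt_or_ge 1 u.lower.card with hcard | hcard
  · have hinter := Finset.card_union_add_card_inter u.lower v.lower
    rw [← h.1.upper_eq, u.card_upper, h.1.1] at hinter
    obtain ⟨r, hr⟩ := Finset.card_pos.1 (show 0 < (u.lower ∩ v.lower).card by lia)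
    obtain ⟨hru, hrv⟩ := Finset.mem_inter.1 hr
    have hrw := h.inter_subset hvw hru hrv
    have hru' := u.lower_subset_upper hru
    have hcard_erase : (u.upper.erase r).card = (u.lower.erase r).card + 1 := by
      rw [Finset.card_erase_of_mem hru, Finset.card_erase_of_mem hru', u.card_upper]
      lia
    have hsub : u.lower.erase r ⊂ u.upper.erase r :=
      Finset.ssubset_iff_subset_ne.2 ⟨Finset.erase_subset_erase r u.lower_subset_upper,
        fun e => by rw [e] at hcard_erase; lia⟩
    have hlne : (u.lower.erase r).Nonempty := by
      rw [← Finset.card_pos, Finset.card_erase_of_mem hru]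
      lia
    let q : PrimitiveVectorField Δ :=
      ⟨u.lower.erase r, u.upper.erase r,
        Δ.mem_faces_of_subset u.lower_mem (Finset.erase_subset _ _) hlne,
        Δ.mem_faces_of_subset u.upper_mem (Finset.erase_subset _ _) (hlne.mono hsub.1), hsub,
        hcard_erase⟩
    have hrq : r ∉ q.upper := Finset.notMem_erase r _
    exact ⟨q, (compatible_of_mem hru hrq).symm, (compatible_of_mem hrv hrq).symm,
      (compatible_of_mem hrw hrq).symm⟩
  · have hcard1 : u.lower.card = 1 :=
      le_antisymm hcard (Δ.isRelLowerSet_faces u.lower_mem).1.card_pos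
    obtain ⟨x, hx⟩ := Finset.card_eq_one.1 hcard1
    obtain ⟨y, hy⟩ := Finset.card_eq_one.1 (h.1.1.trans hcard1)
    obtain ⟨z, hz⟩ := Finset.card_eq_one.1 (h.2.1.1.trans (h.1.1.trans hcard1))
    have huu := h.1.upper_eq
    have hvu := h.2.1.upper_eq
    have hwu := h.2.2.upper_eq
    have hxy : x ≠ y := fun e => h.1.2.1 (by rw [hx, hy, e])
    have hyz : y ≠ z := fun e => h.2.1.2.1 (by rw [hy, hz, e])
    have hzx : z ≠ x := fun e => h.2.2.2.1 (by rw [hz, hx, e])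
    rw [hx, hy] at huu
    rw [hy, hz] at hvu
    rw [hz, hx] at hwu
    by_contra! hno
    have hvert (s t : V) (hst : s ≠ t) (hface : {s, t} ∈ Δ.faces) : s = x ∨ s = y ∨ s = z := by
      by_contra! hs
      let q : PrimitiveVectorField Δ :=
        ⟨{s}, {s, t}, Δ.mem_faces_of_subset hface (by simp) (by simp), hface,
          Finset.ssubset_iff_subset_ne.2 ⟨by simp, fun e => hst (by
            have : t ∈ ({s} : Finset V) := e ▸ (by simp)
            exact (Finset.mem_singleton.1 this).symm)⟩, by simp [hst]⟩
      have hsq : s ∈ q.lower := Finset.mem_singleton_self s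
      exact hno q (compatible_of_mem hsq (by simp [huu, hs])) (compatible_of_mem hsq
        (by simp [hvu, hs])) (compatible_of_mem hsq (by simp [hwu, hs]))
    let pt : Fin 3 → V := ![x, y, z]
    have hpt : Function.Injective pt := by
      intro i j hij
      fin_cases i <;> fin_cases j <;> simp_all [pt, eq_comm]
    have hup (p : PrimitiveVectorField Δ) (s : V) (hs : s ∈ p.upper) : ∃ i, pt i = s := by
      obtain ⟨t, ht, hts⟩ := Finset.exists_mem_ne (s := p.upper) (by
        have := (Δ.isRelLowerSet_faces p.lower_mem).1.card_pos
        rw [p.card_upper]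
        lia) s
      rcases hvert s t hts.symm (Δ.mem_faces_of_subset p.upper_mem
        (by simp [Finset.insert_subset_iff, hs, ht]) (by simp)) with rfl | rfl | rfl
      exacts [⟨0, rfl⟩, ⟨1, rfl⟩, ⟨2, rfl⟩]
    obtain ⟨c, hc, hc'⟩ := exists_cocycle_of_triangle hpt hup
      (by convert u.upper_mem; rw [huu]; ext s; simp [pt, Fin.exists_fin_succ, eq_comm])
      (by convert v.upper_mem; rw [hvu]; ext s; simp [pt, Fin.exists_fin_succ, eq_comm])
      (by convert w.upper_mem; rw [hwu]; ext s; simp [pt, Fin.exists_fin_succ, eq_comm, or_comm])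
    exact hc' (hcob c hc)

theorem finite_primitiveVectorField (hΔ : Δ.faces.Finite) : Finite (PrimitiveVectorField Δ) := by
  have := hΔ.to_subtype
  refine Finite.of_injective
    (fun p : PrimitiveVectorField Δ => ((⟨p.lower, p.lower_mem⟩, ⟨p.upper, p.upper_mem⟩) :
      Δ.faces × Δ.faces)) fun p q h => ?_
  simp only [Prod.mk.injEq, Subtype.mk.injEq] at h
  exact PrimitiveVectorField.ext h.1 h.2

theorem IsEdgeCocycle.mono {P : Type*} {K L : PreAbstractSimplicialComplex P}
    (hKL : K.faces ⊆ L.faces) {G : Type*} [Group G] {c : P → P → G} (hc : IsEdgeCocycle L c) :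
    IsEdgeCocycle K c :=
  fun s hs => hc s (hKL hs)

theorem IsEdgeCoboundary.mono {P : Type*} {K L : PreAbstractSimplicialComplex P}
    (hKL : K.faces ⊆ L.faces) {G : Type*} [Group G] {c : P → P → G} (hc : IsEdgeCoboundary L c) :
    IsEdgeCoboundary K c :=
  let ⟨f, hf⟩ := hc
  ⟨f, fun s hs => hf s (hKL hs)⟩

open Classical in
theorem IsEdgeCoboundary.generalizedMorseComplex {G : Type*} [Group G]
    {c : PrimitiveVectorField Δ → PrimitiveVectorField Δ → G}
    (hc : IsEdgeCoboundary (morseComplex Δ) c) : IsEdgeCoboundary (generalizedMorseComplex Δ) c :=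
  let ⟨f, hf⟩ := hc
  ⟨f, fun s hs p hp q hq => hf {p, q} (mem_faces_morseComplex_of_card_le_two
    (PreAbstractSimplicialComplex.mem_faces_of_subset hs
      (by simp [Finset.insert_subset_iff, hp, hq]) (by simp)) Finset.card_le_two)
    p (by simp) q (by simp)⟩

end MissingTriangles

theorem mainTheorem5 {V : Type*} (Δ : PreAbstractSimplicialComplex V) (hΔ : Δ.faces.Finite) :
    (ConnectedSpace (geometricRealization (morseComplex Δ)) ↔
      ConnectedSpace (geometricRealization (generalizedMorseComplex Δ))) ∧
    (SimplyConnectedSpace (geometricRealization (morseComplex Δ)) ↔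
      SimplyConnectedSpace (geometricRealization (generalizedMorseComplex Δ))) := by
  have := finite_primitiveVectorField hΔ
  refine ⟨?_, fun h => ?_, fun h => ?_⟩
  · rw [connectedSpace_geometricRealization_iff, connectedSpace_geometricRealization_iff,
      edgeConnected_morseComplex_iff]
  · refine simplyConnectedSpace_of_cocycles
      (edgeConnected_morseComplex_iff.1 edgeConnected_of_connectedSpace) fun b c hc => ?_
    exact (hc.mono morseComplex_faces_subset).isEdgeCoboundary.generalizedMorseComplex
  · refine simplyConnectedSpace_of_cocycles
      (edgeConnected_morseComplex_iff.2 edgeConnected_of_connectedSpace) fun b c hc => ?_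
    have hc' := isEdgeCocycle_generalizedMorseComplex hc fun u v w hW hcyc =>
      hcyc.exists_compatible (fun c hc => hc.isEdgeCoboundary)
        (hW v (by simp) w (by simp) hcyc.2.1.ne)
    exact hc'.isEdgeCoboundary.mono morseComplex_faces_subset
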